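/- A (real-valued) cost register automaton (CRA) consists of a finite alphabet $\Sigma$, a finite state set $Q$, a finite register set $X$, an initial state $q_0$ and initial valuation $x_0\in\mathbb R^X$, a transition function $\delta:Q\times\Sigma\to Q$, register updates $f:Q\times\Sigma\times\mathbb R^X\to\mathbb R^X$ and an output function $\mu:Q\times\mathbb R^X\to\mathbb R$. Its semantics is $[\![\mathcal A]\!](w_1\cdots w_m)=\mu(q_m,x_m)$, where $q_i=\delta(q_{i-1},w_i)$ and $x_i=f(q_{i-1},w_i,x_{i-1})$. Its total mass is $\sum_{w\in\Sigma^*}[\![\mathcal A]\!](w)$, where convergence means unconditional convergence. Consider CRAs with rational initial valuation, rational affine register updates ($f(q,\sigma,x)=A_{q,\sigma}x+b_{q,\sigma}$), and an equality-test output: in each state $q$ the output is $1$ if two designated registers (depending on $q$) have equal values, and $0$ otherwise. Such a CRA is given as a finite object by listing these data. **Theorem.** 1. It is undecidable, given such a CRA $\mathcal A$, whether its total mass $\sum_{w\in\Sigma^*}[\![\mathcal A]\!](w)$ converges. 2. This remains undecidable when $\mathcal A$ is restricted to have a single state and exactly four registers. 3. There is a computable map that sends each instance $I=((u_1,v_1),\dots,(u_k,v_k))$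 of the Post Correspondence Problem over a nine-letter alphabet to such a CRA $\mathcal A_I$ over a $k$-letter alphabet with a single state and four registers, such that the total mass of $\mathcal A_I$ equals $1$ if $I$ has no solution and is $+\infty$ if $I$ has a solution. Here a solution is a nonempty index sequence $i_1,\dots,i_m$ with $u_{i_1}\cdots u_{i_m}=v_{i_1}\cdots v_{i_m}$. -/

import Mathlib

open Filter

/-- A real-valued cost register automaton with alphabet `S`, states `Q` and registers `X`.
Finiteness of the three types is imposed where the structure is used. -/
structure CRA (S Q X : Type) where
  /-- initial state -/
  q₀ : Q
  /-- initial register valuation -/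
  x₀ : X → ℝ
  /-- deterministic transition function -/
  δ : Q → S → Q
  /-- register updates -/
  f : Q → S → (X → ℝ) → (X → ℝ)
  /-- output function -/
  μ : Q → (X → ℝ) → ℝ

namespace CRA

variable {S Q X : Type}

/-- One step of the run: read the letter `s` in the configuration `c`. -/
def step (M : CRA S Q X) (c : Q × (X → ℝ)) (s : S) : Q × (X → ℝ) :=
  (M.δ c.1 s, M.f c.1 s c.2)

/-- The last configuration of the unique run on `w`. -/
def run (M : CRA S Q X) (w : List S) : Q × (X → ℝ) :=
  w.foldl M.step (M.q₀, M.x₀)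

/-- The quantitative language computed by `M`. -/
def sem (M : CRA S Q X) (w : List S) : ℝ :=
  M.μ (M.run w).1 (M.run w).2

/-- All register updates are affine maps. -/
def HasAffineUpdates [Fintype X] (M : CRA S Q X) : Prop :=
  ∀ q s, ∃ (A : Matrix X X ℝ) (b : X → ℝ), ∀ x, M.f q s x = A.mulVec x + b

/-- In every state the output is an equality test between two registers. -/
def HasEqualityTestOutput (M : CRA S Q X) : Prop :=
  ∀ q, ∃ i j : X, ∀ x, (x i = x j → M.μ q x = 1) ∧ (x i ≠ x j → M.μ q x = 0)

end CRA

/-- The total mass of `g` (the sum over all words) converges. The set of words carries no preferred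
order, so this is unconditional summability. -/
def MassConverges {S : Type} (g : List S → ℝ) : Prop :=
  Summable g

/-- The total mass of `g` is `+∞`: the net of finite partial sums tends to `+∞`. -/
def MassInfinite {S : Type} (g : List S → ℝ) : Prop :=
  Tendsto (fun F : Finset (List S) => ∑ w ∈ F, g w) atTop atTop

/-- A finite description of a CRA with `k` letters, `n` states and `d` registers, whose initial
valuation and affine updates `x ↦ A x + b` are rational and whose output in state `q` tests equality
of the two registers `out q`. -/
structure AffineCRA (k n d : ℕ) where
  q₀ : Fin n
  x₀ : Fin d → ℚ
  δ : Fin n → Fin k → Fin n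
  A : Fin n → Fin k → Matrix (Fin d) (Fin d) ℚ
  b : Fin n → Fin k → Fin d → ℚ
  out : Fin n → Fin d × Fin d

/-- Raw finite data, on which algorithms operate: rationals are pairs (numerator, denominator),
states and registers are numbers, vectors and tables are lists. The components are: the three sizes;
the initial state and valuation; for every state and letter, the successor state together with the
rows of `A`, each paired with the entry of `b`; for every state, the two tested registers. -/
abbrev CRACode : Type :=
  (ℕ × ℕ × ℕ) × (ℕ × List (ℤ × ℕ)) × List (List (ℕ × List (List (ℤ × ℕ) × (ℤ × ℕ)))) × List (ℕ × ℕ)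

/-- A rational as a reduced fraction. -/
def ratCode (r : ℚ) : ℤ × ℕ := (r.num, r.den)

theorem ratCode_injective : Function.Injective ratCode := by
  intro r s h
  simp only [ratCode, Prod.mk.injEq] at h
  exact Rat.ext h.1 h.2

namespace AffineCRA

variable {k n d : ℕ}

/-- The CRA that a description stands for. -/
noncomputable def toCRA (M : AffineCRA k n d) : CRA (Fin k) (Fin n) (Fin d) where
  q₀ := M.q₀
  x₀ := fun i => (M.x₀ i : ℝ)
  δ := M.δ
  f := fun q s x => ((M.A q s).map (fun r : ℚ => (r : ℝ))).mulVec x + fun i => (M.b q s i : ℝ)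
  μ := fun q x => if x (M.out q).1 = x (M.out q).2 then 1 else 0

theorem toCRA_hasAffineUpdates (M : AffineCRA k n d) : M.toCRA.HasAffineUpdates :=
  fun _ _ => ⟨_, _, fun _ => rfl⟩

theorem toCRA_hasEqualityTestOutput (M : AffineCRA k n d) : M.toCRA.HasEqualityTestOutput :=
  fun q => ⟨(M.out q).1, (M.out q).2, fun _ => ⟨fun h => if_pos h, fun h => if_neg h⟩⟩

/-- The quantitative language of the described CRA. -/
noncomputable def sem (M : AffineCRA k n d) : List (Fin k) → ℝ := M.toCRA.sem

/-- The description as raw data. -/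
def code (M : AffineCRA k n d) : CRACode :=
  ((k, n, d),
   ((M.q₀ : ℕ), List.ofFn fun i => ratCode (M.x₀ i)),
   (List.ofFn fun q => List.ofFn fun s =>
     ((M.δ q s : ℕ),
      List.ofFn fun i => (List.ofFn fun j => ratCode (M.A q s i j), ratCode (M.b q s i)))),
   List.ofFn fun q => (((M.out q).1 : ℕ), ((M.out q).2 : ℕ)))

/-- Descriptions can be recovered from their raw data. -/
theorem code_injective :
    Function.Injective (fun M : AffineCRA k n d => M.code) := by
  rintro ⟨q, x, t, A, b, o⟩ ⟨q', x', t', A', b', o'⟩ h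
  simp only [code, Prod.mk.injEq, List.ofFn_inj, funext_iff, ratCode_injective.eq_iff,
    Fin.val_inj, true_and] at h
  obtain ⟨⟨hq, hx⟩, ht, ho⟩ := h
  simp only [mk.injEq]
  refine ⟨hq, funext hx, ?_, ?_, ?_, ?_⟩
  · funext p s; exact (ht p s).1
  · funext p s i j; exact ((ht p s).2 i).1 j
  · funext p s i; exact ((ht p s).2 i).2
  · funext p; exact Prod.ext (ho p).1 (ho p).2

end AffineCRA

/-- An instance of the Post Correspondence Problem over a nine-letter alphabet: a finite list of
pairs of words. -/
abbrev PCPInstance : Type := List (List (Fin 9) × List (Fin 9))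

/-- Some nonempty sequence of indices gives the same concatenation of first and second words. -/
def PCPInstance.Solvable (I : PCPInstance) : Prop :=
  ∃ w : List (Fin I.length), w ≠ [] ∧
    w.flatMap (fun i => (I.get i).1) = w.flatMap (fun i => (I.get i).2)

/-! Appending a word `u` with digits 1 to 9 to a decimal numeral is the affine map `x ↦ 10 ^ |u| * x
+ c`. Two registers can thus store both concatenations of a correspondence instance, and as zero is
not a digit, the registers agree exactly when the words do (`PCPInstance.toAffineCRA_sem`). The
empty word always contributes 1. Without a solution nothing else contributes; with a solution `w`,
all powers of `w` contribute 1 and the mass is infinite. So convergence is equivalent to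
unsolvability.

Undecidability of the correspondence problem comes from a single Turing machine for the universal
function `n ↦ eval (code n) 0`. The machine becomes a finite semi-Thue system
(`TM0.reaches_halt_iff`), and that system becomes a set of tiles
(`exists_pcpInstance_solvable_iff`). Only the first tile depends on `n`, through its binary digits,
so the reduction is primitive recursive without any analysis of the compilation. -/

/-! ### Derivations of a semi-Thue system as matches of tiles. -/

section Rewriting

variable {α β : Type*}

/-- One rewriting step of the semi-Thue system with rules `R`. -/
inductive SemiThueStep (R : Set (List α × List α)) : List α → List α → Prop
  | intro (x y : List α) {l r : List α} (h : (l, r) ∈ R) :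
      SemiThueStep R (x ++ l ++ y) (x ++ r ++ y)

/-- Reachability in the semi-Thue system with rules `R`. -/
abbrev SemiThueReaches (R : Set (List α × List α)) : List α → List α → Prop :=
  Relation.ReflTransGen (SemiThueStep R)

theorem SemiThueReaches.of_mem {R : Set (List α × List α)} (x y : List α) {l r : List α}
    (h : (l, r) ∈ R) : SemiThueReaches R (x ++ l ++ y) (x ++ r ++ y) :=
  .single (.intro x y h)

/-- The correspondence problem for a set of pairs of words over an arbitrary alphabet. -/
def PostSolvable (T : Set (List α × List α)) : Prop :=
  ∃ w : List (List α × List α), w ≠ [] ∧ (∀ t ∈ w, t ∈ T) ∧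
    w.flatMap Prod.fst = w.flatMap Prod.snd

/-- An alphabet enlarged by four markers. -/
inductive Marked (α : Type*)
  | star
  | start
  | finish
  | sep
  | sym (a : α)

namespace Marked

/-- Put a star behind every letter. -/
def starAfter (w : List (Marked α)) : List (Marked α) := w.flatMap fun a => [a, star]

/-- Put a star before every letter. -/
def starBefore (w : List (Marked α)) : List (Marked α) := w.flatMap fun a => [star, a]

@[simp] theorem starAfter_nil : starAfter ([] : List (Marked α)) = [] := rfl
@[simp] theorem starBefore_nil : starBefore ([] : List (Marked α)) = [] := rfl
@[simp] theorem starAfter_cons (a : Marked α) (w) : starAfter (a :: w) = a :: star :: starAfter w :=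
  rfl
@[simp] theorem starBefore_cons (a : Marked α) (w) :
    starBefore (a :: w) = star :: a :: starBefore w :=
  rfl
@[simp] theorem starAfter_append (v w : List (Marked α)) :
    starAfter (v ++ w) = starAfter v ++ starAfter w := by simp [starAfter]
@[simp] theorem starBefore_append (v w : List (Marked α)) :
    starBefore (v ++ w) = starBefore v ++ starBefore w := by simp [starBefore]

/-- The two star conventions differ by a shift of one star; this is how first and second words of
tiles are aligned. -/
theorem star_cons_starAfter (w : List (Marked α)) :
    star :: starAfter w = starBefore w ++ [star] := by
  induction w with
  | nil => rfl
  | cons a w ih => simp [ih]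

/-- The first tile of a solution; it presents the word `s`. -/
def startTile (s : List α) : List (Marked α) × List (Marked α) :=
  (start :: star :: starAfter (s.map sym ++ [sep]), [start])

/-- The last tile of a solution; it consumes the word `t`. -/
def finishTile (t : List α) : List (Marked α) × List (Marked α) :=
  ([finish], starBefore (t.map sym ++ [sep]) ++ [star, finish])

/-- The tile that separates successive words of a derivation. -/
def sepTile : List (Marked α) × List (Marked α) := (starAfter [sep], starBefore [sep])

/-- The tile of a rewriting rule. -/
def ruleTile (p : List α × List α) : List (Marked α) × List (Marked α) :=
  (starAfter (p.2.map sym), starBefore (p.1.map sym))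

/-- The tiles that do not depend on the first word of a derivation. -/
def tiles (R : Set (List α × List α)) (t : List α) : Set (List (Marked α) × List (Marked α)) :=
  insert (finishTile t) (insert sepTile (ruleTile '' R))

/-- The separator behind `x` differs from every symbol, so a rule cannot read across the end of the
current word. -/
theorem exists_prefix_of_starBefore_eq {x l : List α} {u v : List (Marked α)}
    (h : starBefore (x.map sym) ++ (star :: sep :: u) = starBefore (l.map sym) ++ v) :
    ∃ x', x = l ++ x' ∧ starBefore (x'.map sym) ++ (star :: sep :: u) = v := by
  induction l generalizing x with
  | nil => exact ⟨x, rfl, h⟩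
  | cons a l ih =>
    cases x with
    | nil => simp at h
    | cons b x =>
      simp only [List.map_cons, starBefore_cons, List.cons_append, List.cons.injEq, true_and,
        sym.injEq] at h
      obtain ⟨rfl, h⟩ := h
      obtain ⟨x', rfl, h'⟩ := ih h
      exact ⟨x', rfl, h'⟩

/-- Invariant of a partial match: the first words are ahead by `x`, a separator and `y`, where `x`
is the unread rest of the current word and `y` the written part of its successor. A rule tile
rewrites `y ++ x`, a separator tile starts the next round, and the finish tile forces `x = t` and `y
= []`. -/
theorem reaches_of_overhang {R : Set (List α × List α)} {s t : List α}
    (w : List (List (Marked α) × List (Marked α)))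
    (hw : ∀ p ∈ w, p ∈ insert (startTile s) (tiles R t)) (x y : List α)
    (h : starBefore (x.map sym) ++ (star :: sep :: (starBefore (y.map sym) ++
      star :: w.flatMap Prod.fst)) = w.flatMap Prod.snd) :
    SemiThueReaches R (y ++ x) t := by
  induction w generalizing x y with
  | nil => simp at h
  | cons p w ih =>
    have hw' := fun q hq => hw q (List.mem_cons_of_mem _ hq)
    rcases hw p List.mem_cons_self with rfl | rfl | rfl | ⟨⟨l, r⟩, hR, rfl⟩
    · cases x <;> simp [startTile] at h
    · simp only [finishTile, List.flatMap_cons, starBefore_append, List.append_assoc] at h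
      obtain ⟨x', rfl, h⟩ := exists_prefix_of_starBefore_eq h
      cases x' with
      | cons => simp at h
      | nil =>
        cases y with
        | cons => simp at h
        | nil => simpa using Relation.ReflTransGen.refl
    · cases x with
      | cons => simp [sepTile] at h
      | nil =>
        have := ih hw' y [] (by simpa [sepTile] using h)
        simpa using this
    · simp only [ruleTile, List.flatMap_cons] at h
      obtain ⟨x', rfl, h'⟩ := exists_prefix_of_starBefore_eq h
      have h1 := ih hw' x' (y ++ r) (by
        rw [← h']
        have := congrArg (fun v => v ++ w.flatMap Prod.fst) (star_cons_starAfter (r.map sym))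
        simp only [List.cons_append, List.append_assoc, List.nil_append] at this
        simp [this])
      have h2 := SemiThueReaches.of_mem y x' hR
      simp only [List.append_assoc] at h1 h2
      exact h2.trans h1

/-- Only the start tile can come first: in every other tile the second word begins with a star and
the first word does not. For rule tiles this needs both sides to be nonempty. -/
theorem reaches_of_postSolvable {R : Set (List α × List α)} {s t : List α}
    (hR : ∀ p ∈ R, p.1 ≠ [] ∧ p.2 ≠ [])
    (h : PostSolvable (insert (startTile s) (tiles R t))) : SemiThueReaches R s t := by
  obtain ⟨_ | ⟨p, w⟩, hne, hw, h⟩ := h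
  · exact absurd rfl hne
  rcases hw p List.mem_cons_self with rfl | rfl | rfl | ⟨⟨l, r⟩, hlr, rfl⟩
  · have := reaches_of_overhang w (fun q hq => hw q (List.mem_cons_of_mem _ hq)) s [] (by
      have e := congrArg (fun v => v ++ w.flatMap Prod.fst)
        (star_cons_starAfter (s.map sym ++ [sep]))
      simp only [startTile, List.flatMap_cons, List.cons_append, List.cons.injEq, true_and,
        List.nil_append] at h
      rw [← h]
      simpa using e.symm)
    simpa using this
  · cases t <;> simp [finishTile] at h
  · simp [sepTile] at h
  · obtain ⟨h1, h2⟩ := hR _ hlr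
    cases l <;> cases r <;> simp_all [ruleTile]

theorem exists_tiles_of_mem {R : Set (List α × List α)} (hR : ∀ a, ([a], [a]) ∈ R) (t x : List α) :
    ∃ w : List (List (Marked α) × List (Marked α)), (∀ p ∈ w, p ∈ tiles R t) ∧
      w.flatMap Prod.fst = starAfter (x.map sym) ∧ w.flatMap Prod.snd = starBefore (x.map sym) := by
  refine ⟨x.map fun a => ruleTile ([a], [a]), ?_, ?_, ?_⟩
  · intro p hp
    obtain ⟨a, -, rfl⟩ := List.mem_map.1 hp
    exact .inr (.inr ⟨_, hR a, rfl⟩)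
  · induction x <;> simp_all [ruleTile]
  · induction x <;> simp_all [ruleTile]

/-- The identity rules copy the context around the rewritten factor. -/
theorem exists_tiles_of_step {R : Set (List α × List α)} (hR : ∀ a, ([a], [a]) ∈ R) (t : List α)
    {x y : List α} (h : SemiThueStep R x y) :
    ∃ w : List (List (Marked α) × List (Marked α)), (∀ p ∈ w, p ∈ tiles R t) ∧
      w.flatMap Prod.fst = starAfter (y.map sym ++ [sep]) ∧
      w.flatMap Prod.snd = starBefore (x.map sym ++ [sep]) := by
  obtain @⟨x, y, l, r, h⟩ := h
  obtain ⟨w₁, h₁, h₁', h₁''⟩ := exists_tiles_of_mem hR t x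
  obtain ⟨w₂, h₂, h₂', h₂''⟩ := exists_tiles_of_mem hR t y
  refine ⟨w₁ ++ ruleTile (l, r) :: (w₂ ++ [sepTile]), ?_, ?_, ?_⟩
  rotate_left
  · simp [h₁', h₂', ruleTile, sepTile]
  · simp [h₁'', h₂'', ruleTile, sepTile]
  · intro p hp
    simp only [List.mem_append, List.mem_cons, List.not_mem_nil, or_false] at hp
    rcases hp with hp | rfl | hp | rfl
    · exact h₁ _ hp
    · exact .inr (.inr ⟨_, h, rfl⟩)
    · exact h₂ _ hp
    · exact .inr (.inl rfl)

theorem postSolvable_of_reaches {R : Set (List α × List α)} (hR : ∀ a, ([a], [a]) ∈ R)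
    {s t : List α} (h : SemiThueReaches R s t) :
    PostSolvable (insert (startTile s) (tiles R t)) := by
  -- The first words stay exactly one derivation word ahead, until the finish tile closes the gap.
  suffices ∃ w : List (List (Marked α) × List (Marked α)), (∀ p ∈ w, p ∈ tiles R t) ∧
      star :: (starAfter (s.map sym ++ [sep]) ++ w.flatMap Prod.fst) =
        w.flatMap Prod.snd ++ star :: starAfter (t.map sym ++ [sep]) by
    obtain ⟨w, hw, e⟩ := this
    refine ⟨startTile s :: (w ++ [finishTile t]), by simp, ?_, ?_⟩
    · intro p hp
      simp only [List.mem_append, List.mem_cons, List.not_mem_nil, or_false] at hp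
      rcases hp with rfl | hp | rfl
      · exact .inl rfl
      · exact .inr (hw _ hp)
      · exact .inr (.inl rfl)
    · rw [star_cons_starAfter] at e
      have := congrArg (fun v => v ++ [finish]) e
      simpa [startTile, finishTile] using this
  suffices ∀ t', SemiThueReaches R s t' →
      ∃ w : List (List (Marked α) × List (Marked α)), (∀ p ∈ w, p ∈ tiles R t) ∧
        star :: (starAfter (s.map sym ++ [sep]) ++ w.flatMap Prod.fst) =
          w.flatMap Prod.snd ++ star :: starAfter (t'.map sym ++ [sep]) from this t h
  intro t' h
  induction h with
  | refl => exact ⟨[], by simp⟩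
  | tail _ hbc ih =>
    obtain ⟨w, hw, e⟩ := ih
    obtain ⟨w', hw', e', e''⟩ := exists_tiles_of_step hR t hbc
    refine ⟨w ++ w', fun p hp => (List.mem_append.1 hp).elim (hw p) (hw' p), ?_⟩
    rw [star_cons_starAfter] at e
    have := congrArg (fun v => v ++ w'.flatMap Prod.fst) e
    simp only [List.flatMap_append, e'', e', List.append_assoc, List.cons_append] at this ⊢
    rw [this]
    simp

end Marked

/-! ### Encoding the tiles over nine letters. -/

/-- An injective homomorphism of free monoids neither creates nor destroys matches. -/
theorem postSolvable_image_iff {f : List α → List β} (hf : Function.Injective f)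
    (hf₁ : ∀ x y, f (x ++ y) = f x ++ f y) (T : Set (List α × List α)) :
    PostSolvable (Prod.map f f '' T) ↔ PostSolvable T := by
  have hf₀ : f [] = [] := by simpa using hf₁ [] []
  have key : ∀ w : List (List α × List α),
      (w.map (Prod.map f f)).flatMap Prod.fst = f (w.flatMap Prod.fst) ∧
      (w.map (Prod.map f f)).flatMap Prod.snd = f (w.flatMap Prod.snd) := by
    intro w
    induction w with
    | nil => simp [hf₀]
    | cons p w ih => simp [hf₁, ih.1, ih.2]
  constructor
  · rintro ⟨w, hne, hw, e⟩
    obtain ⟨w, rfl⟩ : ∃ w' : List (List _ × List _), w'.map (Prod.map f f) = w := by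
      have : w ∈ Set.range (List.map (Prod.map f f)) := by
        rw [Set.range_list_map]
        intro p hp
        obtain ⟨q, -, rfl⟩ := hw p hp
        exact ⟨q, rfl⟩
      exact this
    refine ⟨w, by simpa using hne, ?_, hf ?_⟩
    · intro p hp
      obtain ⟨q, hq, e⟩ := hw _ (List.mem_map_of_mem hp)
      exact (hf.prodMap hf e) ▸ hq
    · rw [← (key w).1, e, (key w).2]
  · rintro ⟨w, hne, hw, e⟩
    refine ⟨w.map (Prod.map f f), by simpa using hne, ?_, ?_⟩
    · intro p hp
      obtain ⟨q, hq, rfl⟩ := List.mem_map.1 hp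
      exact ⟨q, hw _ hq, rfl⟩
    · rw [(key w).1, (key w).2, e]

theorem flatMap_injective_of_prefixFree {f : α → List β} (hf₀ : ∀ a, f a ≠ [])
    (hf : ∀ a b x y, f a ++ x = f b ++ y → a = b) :
    Function.Injective fun w : List α => w.flatMap f := by
  intro v
  induction v with
  | nil =>
    rintro (_ | ⟨b, w⟩) h
    · rfl
    · simp [hf₀] at h
  | cons a v ih =>
    rintro (_ | ⟨b, w⟩) h
    · simp [hf₀] at h
    · simp only [List.flatMap_cons] at h
      obtain rfl := hf _ _ _ _ h
      rw [ih (List.append_cancel_left h)]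

/-- A prefix code for marked letters, given a numbering of the letters. -/
def Marked.toFin9 (e : α → ℕ) : Marked α → List (Fin 9)
  | star => [2]
  | start => [3]
  | finish => [4]
  | sep => [5]
  | sym a => List.replicate (e a) 0 ++ [1]

theorem Marked.toFin9_flatMap_injective {e : α → ℕ} (he : Function.Injective e) :
    Function.Injective fun w : List (Marked α) => w.flatMap (toFin9 e) := by
  -- The first 1 ends the unary block, so the block length can be read off.
  have key : ∀ (m n : ℕ) (x y : List (Fin 9)),
      List.replicate m 0 ++ 1 :: x = List.replicate n 0 ++ 1 :: y → m = n := by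
    intro m
    induction m with
    | zero => rintro (_ | n) x y h <;> simp_all [List.replicate_succ]
    | succ m ih =>
      rintro (_ | n) x y h
      · simp [List.replicate_succ] at h
      · simp only [List.replicate_succ, List.cons_append, List.cons.injEq, true_and] at h
        rw [ih n x y h]
  apply flatMap_injective_of_prefixFree
  · intro a; cases a <;> simp [toFin9]
  · intro a b x y h
    have key' : ∀ (n : ℕ) (c : Fin 9) (x y : List (Fin 9)), c ≠ 0 → c ≠ 1 →
        List.replicate n 0 ++ 1 :: x ≠ c :: y := by
      rintro (_ | n) c x y h0 h1 h
      · simp at h; exact h1 h.1.symm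
      · simp [List.replicate_succ] at h; exact h0 h.1.symm
    cases a <;> cases b <;>
      simp only [toFin9, List.append_assoc, List.cons_append, List.nil_append] at h
    all_goals first
      | rfl
      | simp at h
      | exact absurd h (key' _ _ _ _ (by decide) (by decide))
      | exact absurd h.symm (key' _ _ _ _ (by decide) (by decide))
      | exact congrArg sym (he (key _ _ _ _ h))

theorem PCPInstance.solvable_iff (I : PCPInstance) : I.Solvable ↔ PostSolvable {p | p ∈ I} := by
  constructor
  · rintro ⟨w, hne, e⟩
    refine ⟨w.map I.get, by simpa using hne, ?_, by simpa [List.flatMap_map] using e⟩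
    intro p hp
    obtain ⟨i, -, rfl⟩ := List.mem_map.1 hp
    exact List.get_mem I i
  · rintro ⟨w, hne, hw, e⟩
    obtain ⟨w, rfl⟩ : ∃ w' : List (Fin I.length), w'.map I.get = w := by
      have : w ∈ Set.range (List.map I.get) := by
        rw [Set.range_list_map]
        intro p hp
        exact List.mem_iff_get.1 (hw p hp)
      exact this
    exact ⟨w, by simpa using hne, by simpa [List.flatMap_map] using e⟩

/-- Derivability in a finite semi-Thue system reduces to the correspondence problem over nine
letters, and only the first word of the first pair depends on the start of the derivation. -/
theorem exists_pcpInstance_solvable_iff [Finite α] {R : Set (List α × List α)} (hfin : R.Finite)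
    (hR : ∀ p ∈ R, p.1 ≠ [] ∧ p.2 ≠ []) (hR' : ∀ a, ([a], [a]) ∈ R) (t : List α) :
    ∃ (a b v : List (Fin 9)) (f : α → List (Fin 9)) (T : PCPInstance), ∀ s,
      PCPInstance.Solvable ((a ++ s.flatMap f ++ b, v) :: T) ↔ SemiThueReaches R s t := by
  obtain ⟨e, he⟩ := Countable.exists_injective_nat α
  have hinj := Marked.toFin9_flatMap_injective he
  set g : List (Marked α) → List (Fin 9) := fun w => w.flatMap (Marked.toFin9 e) with hg
  have hT : (Prod.map g g '' Marked.tiles R t).Finite :=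
    (((hfin.image _).insert _).insert _).image _
  refine ⟨g [.start, .star], g (Marked.starAfter [.sep]), g [.start],
    fun a => g (Marked.starAfter [.sym a]), hT.toFinset.toList, fun s => ?_⟩
  have h1 : g [.start, .star] ++ s.flatMap (fun a => g (Marked.starAfter [.sym a])) ++
      g (Marked.starAfter [.sep]) = g (Marked.startTile s).1 := by
    have : s.flatMap (fun a => g (Marked.starAfter [.sym a])) =
        g (Marked.starAfter (s.map .sym)) := by
      induction s with
      | nil => rfl
      | cons a s ih =>
        rw [List.flatMap_cons, ih]
        simp [hg]
    rw [this]
    simp [Marked.startTile, hg]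
  have h2 : {p | p ∈ (g (Marked.startTile s).1, g [.start]) :: hT.toFinset.toList} =
      Prod.map g g '' insert (Marked.startTile s) (Marked.tiles R t) := by
    ext p
    rw [Set.image_insert_eq]
    simp [Marked.startTile]
  rw [h1, PCPInstance.solvable_iff, h2,
    postSolvable_image_iff hinj (fun x y => List.flatMap_append)]
  exact ⟨Marked.reaches_of_postSolvable hR, Marked.postSolvable_of_reaches hR'⟩

end Rewriting

/-! ### Turing machines as semi-Thue systems. -/

section Tape

open Turing

variable {Γ Λ : Type*}

/-- Letters of the words that describe the configurations of a Turing machine. -/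
inductive TapeLetter (Γ Λ : Type*)
  | left
  | right
  | halt
  | state (q : Λ)
  | tape (a : Γ)

namespace TapeLetter

instance [Finite Γ] [Finite Λ] : Finite (TapeLetter Γ Λ) := by
  refine Finite.of_surjective (α := Fin 3 ⊕ Λ ⊕ Γ)
    (Sum.elim (fun i => if i = 0 then left else if i = 1 then right else halt)
      (Sum.elim state tape)) ?_
  rintro (_ | _ | _ | q | a)
  · exact ⟨.inl 0, rfl⟩
  · exact ⟨.inl 1, rfl⟩
  · exact ⟨.inl 2, rfl⟩
  · exact ⟨.inr (.inl q), rfl⟩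
  · exact ⟨.inr (.inr a), rfl⟩

end TapeLetter

namespace Turing.TM0

open TapeLetter

/-- The word for a state, the tape to the left of the head (reversed), and the tape from the head
on. -/
def word (q : Λ) (l r : List Γ) : List (TapeLetter Γ Λ) :=
  left :: l.reverse.map tape ++ state q :: (r.map tape ++ [right])

theorem halt_notMem_word (q : Λ) (l r : List Γ) : halt ∉ word q l r := by simp [word]

/-- A configuration word has only one state letter, which fixes where a rule can apply. -/
theorem eq_of_append_state_cons_eq_word {q q' : Λ} {l r : List Γ} {x y : List (TapeLetter Γ Λ)}
    (h : x ++ state q' :: y = word q l r) :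
    x = left :: l.reverse.map tape ∧ q' = q ∧ y = r.map tape ++ [right] := by
  have := (List.append_cons_inj_of_notMem (a₂ := state q') (by simp) (by simp)).1 h.symm
  simpa [eq_comm] using this

theorem eq_of_append_tape_eq {x : List (TapeLetter Γ Λ)} {l : List Γ} {b : Γ}
    (h : x ++ [tape b] = left :: l.reverse.map tape) :
    ∃ l', l = b :: l' ∧ x = left :: l'.reverse.map tape := by
  cases l with
  | nil => cases x <;> simp at h
  | cons a l =>
    simp only [List.reverse_cons, List.map_append, List.map_cons, List.map_nil,
      ← List.cons_append] at h
    obtain ⟨h, h'⟩ := List.append_inj' h rfl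
    simp only [List.cons.injEq, tape.injEq, and_true] at h'
    exact ⟨l, by rw [h'], h⟩

variable [Inhabited Γ] [Inhabited Λ] (M : Machine Γ Λ)

/-- The rewriting rule for state `q`, scanned symbol `a` and symbol `b` to the left of it. -/
def actionRule (q : Λ) (a b : Γ) : List (TapeLetter Γ Λ) × List (TapeLetter Γ Λ) :=
  match M q a with
  | none => ([state q, tape a], [halt])
  | some (q', .write c) => ([state q, tape a], [state q', tape c])
  | some (q', .move .right) => ([state q, tape a], [tape a, state q'])
  | some (q', .move .left) => ([tape b, state q, tape a], [state q', tape b, tape a])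

/-- The semi-Thue system that simulates `M`. A halting letter absorbs its neighbours. -/
def rules : Set (List (TapeLetter Γ Λ) × List (TapeLetter Γ Λ)) :=
  Set.range (fun x => ([x], [x])) ∪
  (Set.range (fun x => ([halt, x], [halt])) ∪
  (Set.range (fun x => ([x, halt], [halt])) ∪
  (Set.range (fun q => ([state q, right], [state q, tape default, right])) ∪
  (Set.range (fun q => ([left, state q], [left, tape default, state q])) ∪
  Set.range (fun p : Λ × Γ × Γ => actionRule M p.1 p.2.1 p.2.2)))))

theorem finite_rules [Finite Γ] [Finite Λ] : (rules M).Finite := by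
  simp only [rules, Set.finite_union]
  exact ⟨Set.finite_range _, Set.finite_range _, Set.finite_range _, Set.finite_range _,
    Set.finite_range _, Set.finite_range _⟩

theorem ne_nil_of_mem_rules {p} (hp : p ∈ rules M) : p.1 ≠ [] ∧ p.2 ≠ [] := by
  rcases hp with ⟨x, rfl⟩ | ⟨x, rfl⟩ | ⟨x, rfl⟩ | ⟨q, rfl⟩ | ⟨q, rfl⟩ | ⟨⟨q, a, b⟩, rfl⟩
  iterate 5 simp
  simp only [actionRule]
  split <;> simp

theorem id_mem_rules (x : TapeLetter Γ Λ) : ([x], [x]) ∈ rules M := .inl ⟨x, rfl⟩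

/-- The word `w` describes the configuration `c`. -/
def Describes (c : Cfg Γ Λ) (w : List (TapeLetter Γ Λ)) : Prop :=
  ∃ l r, c.Tape = Tape.mk' (ListBlank.mk l) (ListBlank.mk r) ∧ w = word c.q l r

theorem describes_init (l : List Γ) : Describes (init l : Cfg Γ Λ) (word default [] l) :=
  ⟨[], l, rfl, rfl⟩

/-- Padding with a blank changes the word but not the tape, so a configuration has many
descriptions. -/
theorem mk_default : ListBlank.mk [(default : Γ)] = ListBlank.mk [] := by
  rw [← ListBlank.cons_mk]
  conv_rhs => rw [← ListBlank.cons_head_tail (ListBlank.mk ([] : List Γ))]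
  rfl

theorem step_eq (M : Machine Γ Λ) (q : Λ) (l r : List Γ) (a : Γ) :
    step M ⟨q, Tape.mk' (ListBlank.mk l) (ListBlank.mk (a :: r))⟩ =
      (M q a).map fun p => ⟨p.1, match p.2 with
        | .move d => (Tape.mk' (ListBlank.mk l) (ListBlank.mk (a :: r))).move d
        | .write b => Tape.mk' (ListBlank.mk l) (ListBlank.mk (b :: r))⟩ := by
  have h : (Tape.mk' (ListBlank.mk l) (ListBlank.mk (a :: r))).1 = a := by
    simp [Tape.mk']
  unfold step
  simp only [h]
  congr 1

/-- Absorption rules need a halting letter, which `w` lacks. Identity and padding rules keep the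
configuration. An action rule must act at the unique state letter and so follows the machine, which
either halts or moves on. -/
theorem describes_of_step {c : Cfg Γ Λ} {w w' : List (TapeLetter Γ Λ)} (hc : Describes c w)
    (h : SemiThueStep (rules M) w w') :
    step M c = none ∨ Describes c w' ∨ ∃ c', step M c = some c' ∧ Describes c' w' := by
  obtain ⟨q, T⟩ := c
  obtain ⟨l, r, hT, hw⟩ := hc
  dsimp only at hT hw
  subst hT
  have hhalt := halt_notMem_word q l r
  obtain @⟨x, y, u, v, hR⟩ := h
  rw [← hw] at hhalt
  rcases hR with ⟨z, hz⟩ | ⟨z, hz⟩ | ⟨z, hz⟩ | ⟨p, hz⟩ | ⟨p, hz⟩ | ⟨⟨p, a, b⟩, hz⟩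
  · cases hz
    exact .inr (.inl ⟨l, r, rfl, hw⟩)
  · cases hz
    simp at hhalt
  · cases hz
    simp at hhalt
  · cases hz
    obtain ⟨rfl, rfl, h⟩ := eq_of_append_state_cons_eq_word (by simpa using hw)
    cases r with
    | cons => simp at h
    | nil =>
      obtain rfl : y = [] := by simpa using h
      exact .inr (.inl ⟨l, [default], by rw [mk_default], by simp [word]⟩)
  · cases hz
    obtain ⟨h, rfl, rfl⟩ := eq_of_append_state_cons_eq_word (x := x ++ [left]) (by simpa using hw)
    cases l with
    | cons a l =>
      rw [List.reverse_cons, List.map_append, ← List.cons_append] at h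
      simpa using (List.append_inj' h rfl).2
    | nil =>
      obtain rfl : x = [] := by simpa using h
      exact .inr (.inl ⟨[default], r, by rw [mk_default], by simp [word]⟩)
  -- A left move also reads the symbol before the state; moving it into `x'` treats all actions
  -- alike.
  · obtain ⟨x', hx', hw'⟩ : ∃ x', x ++ u = x' ++ [state p, tape a] ∧
        x' ++ state p :: tape a :: y = word q l r := by
      rw [← hw]
      simp only [actionRule] at hz
      split at hz <;> cases hz
      iterate 3 exact ⟨x, by simp, by simp⟩
      exact ⟨x ++ [tape b], by simp, by simp⟩
    obtain ⟨rfl, rfl, h⟩ := eq_of_append_state_cons_eq_word hw'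
    cases r with
    | nil => simp at h
    | cons a' r =>
      simp only [List.map_cons, List.cons_append, List.cons.injEq, tape.injEq] at h
      obtain ⟨rfl, rfl⟩ := h
      rw [step_eq]
      simp only [actionRule] at hz
      split at hz <;> cases hz
      · rename_i e
        left; simp [e]
      · rename_i q' c e
        right; right
        refine ⟨_, by rw [e]; rfl, l, c :: r, rfl, ?_⟩
        obtain rfl : x = left :: l.reverse.map tape := by
          simpa using List.append_cancel_right hx'
        simp [word]
      · rename_i q' e
        right; right
        refine ⟨_, by rw [e]; rfl, a :: l, r, by simp [← ListBlank.cons_mk], ?_⟩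
        obtain rfl : x = left :: l.reverse.map tape := by
          simpa using List.append_cancel_right hx'
        simp [word]
      · rename_i q' e
        right; right
        obtain ⟨l', rfl, rfl⟩ := eq_of_append_tape_eq (x := x) (b := b) (l := l)
          (List.append_cancel_right (by simpa using hx'))
        refine ⟨_, by rw [e]; rfl, l', b :: a :: r, ?_, ?_⟩
        · simp [← ListBlank.cons_mk]
        · simp [word]

theorem dom_of_reaches {c : Cfg Γ Λ} {w : List (TapeLetter Γ Λ)} (hc : Describes c w)
    (h : SemiThueReaches (rules M) w [halt]) : (StateTransition.eval (step M) c).Dom := by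
  induction h using Relation.ReflTransGen.head_induction_on generalizing c with
  | refl =>
    obtain ⟨l, r, -, hw⟩ := hc
    simp [word] at hw
  | head hstep _ ih =>
    rcases describes_of_step M hc hstep with h | h | ⟨c', h, h'⟩
    · exact Part.dom_iff_mem.2 ⟨c, StateTransition.mem_eval.2 ⟨.refl, h⟩⟩
    · exact ih h
    · rw [StateTransition.reaches_eval (.single h)]
      exact ih h'

theorem reaches_halt_right (x y : List (TapeLetter Γ Λ)) :
    SemiThueReaches (rules M) (x ++ halt :: y) (x ++ [halt]) := by
  induction y with
  | nil => exact .refl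
  | cons a y ih =>
    refine .trans ?_ ih
    simpa using SemiThueReaches.of_mem (R := rules M) x y (l := [halt, a]) (r := [halt])
      (.inr (.inl ⟨a, rfl⟩))

theorem reaches_halt_left (x : List (TapeLetter Γ Λ)) :
    SemiThueReaches (rules M) (x ++ [halt]) [halt] := by
  induction x using List.reverseRecOn with
  | nil => exact .refl
  | append_singleton x a ih =>
    refine .trans ?_ ih
    simpa using SemiThueReaches.of_mem (R := rules M) x [] (l := [a, halt]) (r := [halt])
      (.inr (.inr (.inl ⟨a, rfl⟩)))

/-- Padding exposes a scanned symbol and a left neighbour, so that every action rule finds its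
left-hand side. -/
theorem exists_reaches_word {c : Cfg Γ Λ} {w : List (TapeLetter Γ Λ)} (hc : Describes c w) :
    ∃ b l a r, c.Tape = Tape.mk' (ListBlank.mk (b :: l)) (ListBlank.mk (a :: r)) ∧
      SemiThueReaches (rules M) w (word c.q (b :: l) (a :: r)) := by
  obtain ⟨l, r, hT, rfl⟩ := hc
  obtain ⟨b, l', hl, h⟩ : ∃ b l', ListBlank.mk l = ListBlank.mk (b :: l') ∧
      SemiThueReaches (rules M) (word c.q l r) (word c.q (b :: l') r) := by
    cases l with
    | cons b l => exact ⟨b, l, rfl, .refl⟩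
    | nil =>
      refine ⟨default, [], mk_default.symm, ?_⟩
      simpa [word] using SemiThueReaches.of_mem (R := rules M) [] (r.map tape ++ [right])
        (.inr (.inr (.inr (.inr (.inl ⟨c.q, rfl⟩)))))
  obtain ⟨a, r', hr, h'⟩ : ∃ a r', ListBlank.mk r = ListBlank.mk (a :: r') ∧
      SemiThueReaches (rules M) (word c.q (b :: l') r) (word c.q (b :: l') (a :: r')) := by
    cases r with
    | cons a r => exact ⟨a, r, rfl, .refl⟩
    | nil =>
      refine ⟨default, [], mk_default.symm, ?_⟩
      simpa [word] using SemiThueReaches.of_mem (R := rules M)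
        (left :: (b :: l').reverse.map tape) [] (.inr (.inr (.inr (.inl ⟨c.q, rfl⟩))))
  exact ⟨b, l', a, r', by rw [hT, hl, hr], h.trans h'⟩

theorem actionRule_mem_rules (q : Λ) (a b : Γ) : actionRule M q a b ∈ rules M :=
  .inr (.inr (.inr (.inr (.inr ⟨(q, a, b), rfl⟩))))

theorem exists_reaches_of_step {c c' : Cfg Γ Λ} {w : List (TapeLetter Γ Λ)} (hc : Describes c w)
    (h : step M c = some c') : ∃ w', Describes c' w' ∧ SemiThueReaches (rules M) w w' := by
  obtain ⟨b, l, a, r, hT, hw⟩ := exists_reaches_word M hc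
  obtain ⟨q, T⟩ := c
  dsimp only at hT hw
  subst hT
  rw [step_eq, Option.map_eq_some_iff] at h
  obtain ⟨⟨q', s⟩, e, rfl⟩ := h
  have hR := actionRule_mem_rules M q a b
  rcases s with (_ | _) | d <;> simp only [actionRule, e] at hR
  · refine ⟨_, ⟨l, b :: a :: r, ?_, rfl⟩, hw.trans ?_⟩
    · simp [← ListBlank.cons_mk]
    · simpa [word] using SemiThueReaches.of_mem (left :: l.reverse.map tape)
        (r.map tape ++ [right]) hR
  · refine ⟨_, ⟨a :: b :: l, r, ?_, rfl⟩, hw.trans ?_⟩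
    · simp [← ListBlank.cons_mk]
    · simpa [word] using SemiThueReaches.of_mem (left :: (b :: l).reverse.map tape)
        (r.map tape ++ [right]) hR
  · refine ⟨_, ⟨b :: l, d :: r, rfl, rfl⟩, hw.trans ?_⟩
    simpa [word] using SemiThueReaches.of_mem (left :: (b :: l).reverse.map tape)
      (r.map tape ++ [right]) hR

theorem reaches_halt_of_step_eq_none {c : Cfg Γ Λ} {w : List (TapeLetter Γ Λ)}
    (hc : Describes c w) (h : step M c = none) : SemiThueReaches (rules M) w [halt] := by
  obtain ⟨b, l, a, r, hT, hw⟩ := exists_reaches_word M hc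
  obtain ⟨q, T⟩ := c
  dsimp only at hT hw
  subst hT
  rw [step_eq, Option.map_eq_none_iff] at h
  have hR := actionRule_mem_rules M q a b
  simp only [actionRule, h] at hR
  refine hw.trans (.trans ?_ ((reaches_halt_right M (left :: (b :: l).reverse.map tape)
    (r.map tape ++ [right])).trans (reaches_halt_left M _)))
  simpa [word] using SemiThueReaches.of_mem (left :: (b :: l).reverse.map tape)
    (r.map tape ++ [right]) hR

theorem reaches_halt_of_reaches {c c' : Cfg Γ Λ} {w : List (TapeLetter Γ Λ)} (hc : Describes c w)
    (h : StateTransition.Reaches (step M) c c') (h' : step M c' = none) :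
    SemiThueReaches (rules M) w [halt] := by
  induction h using Relation.ReflTransGen.head_induction_on generalizing w with
  | refl => exact reaches_halt_of_step_eq_none M hc h'
  | head hstep _ ih =>
    obtain ⟨w', hw', hr⟩ := exists_reaches_of_step M hc hstep
    exact hr.trans (ih hw')

/-- A Turing machine halts if and only if its semi-Thue system derives the halting letter. -/
theorem reaches_halt_iff (l : List Γ) :
    SemiThueReaches (rules M) (word default [] l) [halt] ↔ (eval M l).Dom := by
  refine ⟨dom_of_reaches M (describes_init l), fun h => ?_⟩
  obtain ⟨c, hc⟩ := Part.dom_iff_mem.1 (show (StateTransition.eval (step M) (init l)).Dom from h)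
  obtain ⟨h₁, h₂⟩ := StateTransition.mem_eval.1 hc
  exact reaches_halt_of_reaches M (describes_init l) h₁ h₂

/-- A machine restricted to a set of states that supports it. -/
def restrict {S : Set Λ} (hS : Supports M S) [Inhabited S] : Machine Γ S := fun q a =>
  (M q a).pmap (fun p hp => (⟨p.1, hp⟩, p.2)) fun _ hp => hS.2 hp q.2

/-- Forgetting membership in `S` is a simulation. Restriction is what makes the state type, and
hence the rule set, finite. -/
theorem restrict_eval_dom {S : Set Λ} (hS : Supports M S) [Inhabited S]
    (hdef : ((default : S) : Λ) = default) (l : List Γ) :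
    (eval (restrict M hS) l).Dom ↔ (eval M l).Dom := by
  have H : StateTransition.Respects (step (restrict M hS)) (step M)
      (fun (c : Cfg Γ S) (c' : Cfg Γ Λ) => (⟨c.q, c.Tape⟩ : Cfg Γ Λ) = c') := by
    rw [StateTransition.fun_respects]
    rintro ⟨q, T⟩
    cases e : M q T.1 with
    | none => simp [step, restrict, e, StateTransition.FRespects]
    | some p =>
      have e' : restrict M hS q T.1 = some (⟨p.1, hS.2 e q.2⟩, p.2) := by simp [restrict, e]
      simp only [step, e', Option.map_some, StateTransition.FRespects]
      exact .single (by simp [step, e])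
  exact (StateTransition.tr_eval_dom H (a₁ := init l) (a₂ := init l) (by simp [init, hdef])).symm

end Turing.TM0
end Tape

/-! ### From partial recursive functions to the correspondence problem. -/

section Undecidability

open Turing

theorem trNat_eq_map_bits (n : ℕ) :
    PartrecToTM2.trNat n =
      n.bits.map fun b => cond b PartrecToTM2.Γ'.bit1 PartrecToTM2.Γ'.bit0 := by
  induction n using Nat.binaryRec' with
  | zero => simp
  | bit b n h ih =>
    rw [Nat.bits_append_bit n b h, List.map_cons, ← ih, PartrecToTM2.trNat, PartrecToTM2.trNat,
      ← Num.ofNat'_eq, Num.ofNat'_bit, Num.ofNat'_eq]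
    cases b with
    | true => cases (n : Num) <;> rfl
    | false =>
      cases e : (n : Num) with
      | zero => exact absurd (h (Num.of_nat_inj.1 e)) (by simp)
      | pos p => rfl

theorem primrec_bits : Primrec Nat.bits := by
  have : Primrec₂ fun (_ : Unit) (n : ℕ) => n.bits := by
    -- The list `l` of earlier values has length `n`; the recursion prepends the parity of `n` to
    -- the bits of `n / 2`.
    refine Primrec.nat_strong_rec _ (g := fun _ l => some
      (bif l.length == 0 then [] else (l.length % 2 == 1) :: l.getD (l.length / 2) [])) ?_ ?_
    · have hl : Primrec fun p : Unit × List (List Bool) => p.2.length :=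
        Primrec.list_length.comp .snd
      refine Primrec.option_some.comp (.cond (Primrec.beq.comp hl (.const 0)) (.const [])
        (Primrec.list_cons.comp (Primrec.beq.comp (Primrec.nat_mod.comp hl (.const 2)) (.const 1))
          ((Primrec.list_getD []).comp .snd (Primrec.nat_div.comp hl (.const 2)))))
    · intro _ n
      cases n using Nat.binaryRec' with
      | zero => simp
      | bit b n h =>
        have h0 : Nat.bit b n ≠ 0 := fun h' => by
          rw [Nat.bit_eq_zero_iff] at h'
          simp [h h'.1] at h'
        have h1 : n < Nat.bit b n := by
          cases b <;> simp_all <;> omega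
        have h2 : Nat.bit b n / 2 = n := by cases b <;> simp; omega
        have h4 : (Nat.bit b n == 0) = false := by simpa using h0
        simp [Nat.bits_append_bit n b h, h2, h1, h4]
  exact this.comp (.const ()) .id

instance : Finite PartrecToTM2.K' :=
  Finite.of_surjective (fun i : Fin 4 => ![.main, .rev, .aux, .stack] i) fun k => by
    cases k
    exacts [⟨0, rfl⟩, ⟨1, rfl⟩, ⟨2, rfl⟩, ⟨3, rfl⟩]

/-- `TM2.init` starts at the default label, so the `Inhabited` instance must select the entry point
of `c`. -/
theorem PartrecToTM2.eval_tr_dom_iff (c : ToPartrec.Code) (v : List ℕ) :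
    (@TM2.eval _ _ _ _ ⟨PartrecToTM2.trNormal c .halt⟩ _ _ PartrecToTM2.tr PartrecToTM2.K'.main
      (PartrecToTM2.trList v)).Dom ↔ (c.eval v).Dom := by
  have h : @TM2.init _ _ _ _ ⟨PartrecToTM2.trNormal c .halt⟩ _ _ PartrecToTM2.K'.main
      (PartrecToTM2.trList v) = PartrecToTM2.init c v := by
    refine TM2.Cfg.mk.injEq .. ▸ ⟨rfl, rfl, ?_⟩
    funext k
    cases k <;> rfl
  have := congrArg Part.Dom (PartrecToTM2.tr_eval c v)
  rw [← h] at this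
  exact iff_of_eq this

/-- A multi-stack machine with finitely many accessible states is simulated by a finite Turing
machine. -/
theorem TM2.exists_machine_dom_iff {K : Type} {Γ : K → Type} {Λ σ : Type} [DecidableEq K]
    [Inhabited Λ] [Inhabited σ] [Finite σ] {M : Λ → TM2.Stmt Γ Λ σ} {S : Finset Λ}
    (hS : TM2.Supports M S) :
    ∃ (Λ₀ : Type) (_ : Inhabited Λ₀) (_ : Finite Λ₀) (M₀ : TM0.Machine (TM2to1.Γ' K Γ) Λ₀),
      ∀ k L, (TM0.eval M₀ (TM2to1.trInit k L)).Dom ↔ (TM2.eval M k L).Dom := by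
  have := Fintype.ofFinite σ
  obtain ⟨T, hS₀⟩ : ∃ T : Finset (TM1to0.Λ' (TM2to1.tr M)),
      TM0.Supports (TM1to0.tr (TM2to1.tr M)) (T : Set (TM1to0.Λ' (TM2to1.tr M))) :=
    ⟨_, TM1to0.tr_supports _ (TM2to1.tr_supports M hS)⟩
  let i : Inhabited (T : Set (TM1to0.Λ' (TM2to1.tr M))) := ⟨⟨default, hS₀.1⟩⟩
  refine ⟨_, i, Finset.finite_toSet T, TM0.restrict _ hS₀, fun k L => ?_⟩
  rw [TM0.restrict_eval_dom _ hS₀ rfl, TM1to0.tr_eval, TM2to1.tr_eval_dom]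

/-- A partial recursive function has a Turing machine with finitely many states and symbols that
halts on the encodings of the elements of its domain only. -/
theorem exists_machine_halts_iff {f : ℕ →. ℕ} (hf : Partrec f) :
    ∃ (Γ Λ : Type) (_ : Inhabited Γ) (_ : Inhabited Λ) (_ : Finite Γ) (_ : Finite Λ)
      (M : TM0.Machine Γ Λ) (a : Γ) (g : Bool → Γ),
      ∀ n : ℕ, (TM0.eval M (a :: n.bits.reverse.map g)).Dom ↔ (f n).Dom := by
  obtain ⟨c, hc⟩ := ToPartrec.Code.exists_code (Nat.Partrec'.part_iff₁.2 hf)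
  obtain ⟨Λ, _, _, M, hM⟩ := @TM2.exists_machine_dom_iff _ _ _ _
    (fun a b => PartrecToTM2.instDecidableEqK' a b) ⟨PartrecToTM2.trNormal c .halt⟩ _ _ _ _
    (PartrecToTM2.tr_supports c .halt)
  -- A tape cell carries a flag for the bottom of the stacks and one entry per stack; initially only
  -- the main stack is filled.
  let φ : PartrecToTM2.Γ' → Bool × (PartrecToTM2.K' → Option PartrecToTM2.Γ') := fun a =>
    (false, Function.update (fun _ => none) PartrecToTM2.K'.main (some a))
  refine ⟨_, Λ, TM2to1.Γ'.inhabited, inferInstance,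
    inferInstanceAs (Finite (Bool × (PartrecToTM2.K' → Option PartrecToTM2.Γ'))), inferInstance,
    M, (true, (φ .cons).2), fun b => φ (cond b .bit1 .bit0), fun n => ?_⟩
  have hinit : TM2to1.trInit PartrecToTM2.K'.main (PartrecToTM2.trList [n]) =
      (true, (φ .cons).2) :: n.bits.reverse.map fun b => φ (cond b .bit1 .bit0) := by
    have : (PartrecToTM2.trList [n]).reverse =
        .cons :: n.bits.reverse.map fun b => cond b .bit1 .bit0 := by
      simp [PartrecToTM2.trList, trNat_eq_map_bits]
    refine (congrArg (fun w : List (Bool × (PartrecToTM2.K' → Option PartrecToTM2.Γ')) =>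
      (true, w.headI.2) :: w.tail) (congrArg (List.map φ) this)).trans ?_
    rw [List.map_cons, List.map_map]
    rfl
  have h := (hM .main (PartrecToTM2.trList [n])).trans (PartrecToTM2.eval_tr_dom_iff c [n])
  rw [hc ⟨[n], rfl⟩] at h
  exact hinit ▸ h

/-- The domain of a partial recursive function reduces to the correspondence problem over nine
letters. -/
theorem exists_pcpInstance_solvable_iff_dom {f : ℕ →. ℕ} (hf : Partrec f) :
    ∃ (a b v : List (Fin 9)) (g : Bool → List (Fin 9)) (T : PCPInstance), ∀ n : ℕ,
      PCPInstance.Solvable ((a ++ n.bits.reverse.flatMap g ++ b, v) :: T) ↔ (f n).Dom := by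
  obtain ⟨Γ, Λ, _, _, _, _, M, c, h, hM⟩ := exists_machine_halts_iff hf
  obtain ⟨a, b, v, g, T, hT⟩ := exists_pcpInstance_solvable_iff (TM0.finite_rules M)
    (fun _ => TM0.ne_nil_of_mem_rules M) (TM0.id_mem_rules M) [.halt]
  refine ⟨a ++ g .left ++ g (.state default) ++ g (.tape c), g .right ++ b, v,
    fun x => g (.tape (h x)), T, fun n => ?_⟩
  rw [← hM, ← TM0.reaches_halt_iff, ← hT]
  simp only [TM0.word, List.flatMap_append, List.flatMap_cons, List.flatMap_map,
    List.map_cons, List.reverse_nil, List.map_nil, List.flatMap_nil, List.append_nil,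
    List.append_assoc]

/-- The Post Correspondence Problem over nine letters is undecidable. -/
theorem PCPInstance.not_computable_solvable (D : PCPInstance → Bool) (hD : Computable D)
    (h : ∀ I, D I = true ↔ ¬ I.Solvable) : False := by
  -- Applied to a universal function, this fixes all data except the input digits; a decider would
  -- solve the halting problem.
  obtain ⟨a, b, v, g, T, hT⟩ := exists_pcpInstance_solvable_iff_dom
    (f := fun n => (Denumerable.ofNat Nat.Partrec.Code n).eval 0)
    (Nat.Partrec.Code.eval_part.comp (Computable.ofNat _) (Computable.const 0))
  refine ComputablePred.halting_problem 0 (ComputablePred.computable_iff.2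
    ⟨fun c => !D ((a ++ (Encodable.encode c).bits.reverse.flatMap g ++ b, v) :: T), ?_, ?_⟩)
  · have h1 : Primrec fun c : Nat.Partrec.Code =>
        ((a ++ (Encodable.encode c).bits.reverse.flatMap g ++ b, v) :: T : PCPInstance) :=
      Primrec.list_cons.comp (.pair (Primrec.list_append.comp (Primrec.list_append.comp (.const a)
        (Primrec.list_flatMap (Primrec.list_reverse.comp (primrec_bits.comp .encode))
          ((Primrec.dom_finite g).comp₂ .right))) (.const b)) (.const v)) (.const T)
    exact Primrec.not.to_comp.comp (hD.comp h1.to_comp)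
  · funext c
    have h1 := hT (Encodable.encode c)
    have h2 := h ((a ++ (Encodable.encode c).bits.reverse.flatMap g ++ b, v) :: T)
    rw [Denumerable.ofNat_encode] at h1
    rw [h1] at h2
    rw [Bool.not_eq_true', ← Bool.not_eq_true, h2, not_not]

end Undecidability

/-! ### The cost register automaton of a correspondence instance. -/

section CostRegister

/-- The number that extends the decimal digits of `x` by the nonzero digits `u + 1`. -/
def appendDigits (x : ℕ) (u : List (Fin 9)) : ℕ :=
  u.foldl (fun a (d : Fin 9) => 10 * a + (d.val + 1)) x

theorem appendDigits_eq (x : ℕ) (u : List (Fin 9)) :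
    appendDigits x u = 10 ^ u.length * x + appendDigits 0 u := by
  induction u generalizing x with
  | nil => simp [appendDigits]
  | cons d u ih =>
    have h : ∀ y, appendDigits y (d :: u) = appendDigits (10 * y + (d + 1)) u := fun _ => rfl
    rw [h, h, ih, ih (10 * 0 + _), List.length_cons]
    ring

theorem appendDigits_append (x : ℕ) (u v : List (Fin 9)) :
    appendDigits x (u ++ v) = appendDigits (appendDigits x u) v := by
  simp [appendDigits]

/-- The last digit is recovered modulo 10; as no digit is zero, only the empty word has value 0. -/
theorem appendDigits_zero_injective : Function.Injective (appendDigits 0) := by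
  have h : ∀ u (d : Fin 9), appendDigits 0 (u ++ [d]) = 10 * appendDigits 0 u + (d + 1) :=
    fun u d => by rw [appendDigits_append]; rfl
  intro u
  induction u using List.reverseRecOn with
  | nil =>
    intro v hv
    induction v using List.reverseRecOn with
    | nil => rfl
    | append_singleton v d => rw [h] at hv; simp [appendDigits] at hv
  | append_singleton u d ih =>
    intro v hv
    induction v using List.reverseRecOn with
    | nil => rw [h] at hv; simp [appendDigits] at hv
    | append_singleton v e =>
      rw [h, h] at hv
      have hd : d = e := by ext; omega
      rw [ih (by omega : appendDigits 0 u = appendDigits 0 v), hd]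

/-- The automaton of a correspondence instance: the first two registers hold the numbers of the two
concatenated words, the other two remain zero. -/
def PCPInstance.toAffineCRA (I : PCPInstance) : AffineCRA I.length 1 4 where
  q₀ := 0
  x₀ := 0
  δ := fun _ _ => 0
  A := fun _ s => Matrix.diagonal
    ![10 ^ (I.get s).1.length, 10 ^ (I.get s).2.length, 0, 0]
  b := fun _ s => ![appendDigits 0 (I.get s).1, appendDigits 0 (I.get s).2, 0, 0]
  out := fun _ => (0, 1)

theorem PCPInstance.toAffineCRA_step (I : PCPInstance) (m n : ℕ) (s : Fin I.length) :
    I.toAffineCRA.toCRA.step (0, ![(m : ℝ), n, 0, 0]) s =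
      (0, ![(appendDigits m (I.get s).1 : ℝ), appendDigits n (I.get s).2, 0, 0]) := by
  refine Prod.ext rfl (funext fun i => ?_)
  have : (Matrix.diagonal ![10 ^ (I.get s).1.length, 10 ^ (I.get s).2.length, 0, 0] :
      Matrix (Fin 4) (Fin 4) ℚ).map (fun r : ℚ => (r : ℝ)) =
      Matrix.diagonal ![10 ^ (I.get s).1.length, 10 ^ (I.get s).2.length, 0, 0] := by
    ext i j
    fin_cases i <;> fin_cases j <;> simp
  simp only [CRA.step, AffineCRA.toCRA, toAffineCRA, this, appendDigits_eq m, appendDigits_eq n]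
  fin_cases i <;> simp [Matrix.mulVec_diagonal]

theorem PCPInstance.toAffineCRA_run (I : PCPInstance) (w : List (Fin I.length)) :
    I.toAffineCRA.toCRA.run w =
      (0, ![(appendDigits 0 (w.flatMap fun i => (I.get i).1) : ℝ),
        appendDigits 0 (w.flatMap fun i => (I.get i).2), 0, 0]) := by
  induction w using List.reverseRecOn with
  | nil =>
    refine Prod.ext rfl (funext fun i => ?_)
    fin_cases i <;> simp [CRA.run, AffineCRA.toCRA, toAffineCRA, appendDigits]
  | append_singleton w s ih =>
    rw [CRA.run, List.foldl_append, ← CRA.run, ih, List.foldl_cons, List.foldl_nil,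
      toAffineCRA_step]
    simp [appendDigits_append]

open Classical in
theorem PCPInstance.toAffineCRA_sem (I : PCPInstance) (w : List (Fin I.length)) :
    I.toAffineCRA.sem w =
      if w.flatMap (fun i => (I.get i).1) = w.flatMap (fun i => (I.get i).2) then 1 else 0 := by
  rw [AffineCRA.sem, CRA.sem, toAffineCRA_run]
  have : (appendDigits 0 (w.flatMap fun i => (I.get i).1) : ℝ) =
      appendDigits 0 (w.flatMap fun i => (I.get i).2) ↔
      w.flatMap (fun i => (I.get i).1) = w.flatMap (fun i => (I.get i).2) := by
    rw [Nat.cast_inj, appendDigits_zero_injective.eq_iff]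
  simp only [← this]
  rfl

theorem PCPInstance.hasSum_sem_of_not_solvable {I : PCPInstance} (h : ¬ I.Solvable) :
    HasSum I.toAffineCRA.sem 1 := by
  have h1 : I.toAffineCRA.sem [] = 1 := by simp [toAffineCRA_sem]
  rw [← h1]
  refine hasSum_single _ fun w hw => ?_
  rw [toAffineCRA_sem, if_neg fun e => h ⟨w, hw, e⟩]

theorem massInfinite_of_infinite {S : Type} {g : List S → ℝ} (h₀ : ∀ w, 0 ≤ g w)
    (h : {w | 1 ≤ g w}.Infinite) : MassInfinite g := by
  refine tendsto_atTop_atTop_of_monotone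
    (fun _ _ hFG => Finset.sum_le_sum_of_subset_of_nonneg hFG fun w _ _ => h₀ w) fun b => ?_
  obtain ⟨n, hn⟩ := exists_nat_ge b
  obtain ⟨F, hF, hcard⟩ := h.exists_subset_card_eq n
  refine ⟨F, hn.trans ?_⟩
  rw [← hcard, ← nsmul_one, ← Finset.sum_const]
  exact Finset.sum_le_sum fun w hw => hF hw

theorem PCPInstance.massInfinite_sem_of_solvable {I : PCPInstance} (h : I.Solvable) :
    MassInfinite I.toAffineCRA.sem := by
  obtain ⟨w, hne, e⟩ := h
  refine massInfinite_of_infinite (fun v => ?_) ?_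
  · rw [toAffineCRA_sem]; split_ifs <;> norm_num
  -- Powers of a solution again equalize both sides, and their lengths distinguish them.
  · refine Set.infinite_of_injective_forall_mem (f := fun n : ℕ => (List.replicate n w).flatten)
      (fun m n hmn => ?_) fun n => ?_
    · have := congrArg List.length hmn
      simpa [hne] using this
    · have : ∀ f : Fin I.length → List (Fin 9), (List.replicate n w).flatten.flatMap f =
          (List.replicate n (w.flatMap f)).flatten := by
        intro f
        induction n with
        | zero => rfl
        | succ n ih => simp [List.replicate_succ, ih]
      rw [Set.mem_ofPred_eq, toAffineCRA_sem, this, this, e, if_pos rfl]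

theorem not_massConverges_of_massInfinite {S : Type} {g : List S → ℝ} (h : MassInfinite g) :
    ¬ MassConverges g := fun ⟨_, ha⟩ => not_tendsto_nhds_of_tendsto_atTop h _ ha

theorem PCPInstance.massConverges_sem_iff (I : PCPInstance) :
    MassConverges I.toAffineCRA.sem ↔ ¬ I.Solvable :=
  ⟨fun h hs => not_massConverges_of_massInfinite (massInfinite_sem_of_solvable hs) h,
    fun h => (hasSum_sem_of_not_solvable h).summable⟩

/-! ### Computability of the reduction. -/

theorem primrec_natCast_int : Primrec (fun n : ℕ => (n : ℤ)) := by
  -- A nonnegative integer `n` is encoded as `2 * n`.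
  refine Primrec.encode_iff.1 ((Primrec.nat_mul.comp (.const 2) .id).of_eq fun n => ?_)
  rfl

theorem primrec_appendDigits : Primrec (appendDigits 0) := by
  refine Primrec.list_foldl (f := fun u : List (Fin 9) => u) (g := fun _ => 0)
    (h := fun _ (p : ℕ × Fin 9) => 10 * p.1 + (p.2.val + 1)) .id (.const 0) ?_
  exact Primrec.nat_add.comp (Primrec.nat_mul.comp (.const 10) (Primrec.fst.comp .snd))
    (Primrec.succ.comp (Primrec.fin_val.comp (Primrec.snd.comp .snd)))

theorem primrec_ten_pow_length : Primrec fun u : List (Fin 9) => 10 ^ u.length := by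
  refine (Primrec.list_foldl (f := fun u : List (Fin 9) => u) .id (.const 1)
    (h := fun _ p => 10 * p.1) ?_).of_eq fun u => ?_
  · exact Primrec.nat_mul.comp (.const 10) (Primrec.fst.comp .snd)
  · induction u using List.reverseRecOn with
    | nil => rfl
    | append_singleton u d ih => simp_all [pow_succ']

/-- The code of a natural number. -/
def natCode (n : ℕ) : ℤ × ℕ := (n, 1)

theorem ratCode_natCast (n : ℕ) : ratCode n = natCode n := rfl

theorem primrec_natCode : Primrec natCode := primrec_natCast_int.pair (.const 1)

/-- The code of the transition of a pair of words. -/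
def transitionCode (p : List (Fin 9) × List (Fin 9)) :
    ℕ × List (List (ℤ × ℕ) × (ℤ × ℕ)) :=
  (0, [([natCode (10 ^ p.1.length), natCode 0, natCode 0, natCode 0], natCode (appendDigits 0 p.1)),
    ([natCode 0, natCode (10 ^ p.2.length), natCode 0, natCode 0], natCode (appendDigits 0 p.2)),
    ([natCode 0, natCode 0, natCode 0, natCode 0], natCode 0),
    ([natCode 0, natCode 0, natCode 0, natCode 0], natCode 0)])

theorem primrec_transitionCode : Primrec transitionCode := by
  have hA {f : List (Fin 9) × List (Fin 9) → List (Fin 9)} (hf : Primrec f) :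
      Primrec fun p => natCode (10 ^ (f p).length) :=
    primrec_natCode.comp (primrec_ten_pow_length.comp hf)
  have hb {f : List (Fin 9) × List (Fin 9) → List (Fin 9)} (hf : Primrec f) :
      Primrec fun p => natCode (appendDigits 0 (f p)) :=
    primrec_natCode.comp (primrec_appendDigits.comp hf)
  refine .pair (.const 0) (Primrec.list_cons.comp (.pair ?_ (hb .fst)) (Primrec.list_cons.comp
    (.pair ?_ (hb .snd)) (.const _)))
  · exact Primrec.list_cons.comp (hA .fst) (.const _)
  · exact Primrec.list_cons.comp (.const _) (Primrec.list_cons.comp (hA .snd) (.const _))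

theorem PCPInstance.code_toAffineCRA (I : PCPInstance) :
    I.toAffineCRA.code = ((I.length, 1, 4),
      (0, [natCode 0, natCode 0, natCode 0, natCode 0]), [I.map transitionCode], [(0, 1)]) := by
  have h : (List.ofFn fun s : Fin I.length => transitionCode (I.get s)) = I.map transitionCode := by
    conv_rhs => rw [← List.ofFn_get I, List.map_ofFn]
    rfl
  rw [← h]
  simp only [AffineCRA.code, toAffineCRA, transitionCode, ← ratCode_natCast]
  simp [List.ofFn_succ, Matrix.diagonal]

theorem PCPInstance.computable_code_toAffineCRA :
    Computable fun I : PCPInstance => I.toAffineCRA.code := by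
  refine Primrec.to_comp (Primrec.of_eq ?_ fun I => (code_toAffineCRA I).symm)
  exact .pair (.pair Primrec.list_length (.const _)) (.pair (.const _) (.pair
    (Primrec.list_cons.comp (Primrec.list_map .id (primrec_transitionCode.comp₂ .right)) (.const []))
    (.const _)))

end CostRegister

theorem mainTheorem4 :
    (¬ ∃ D : CRACode → Bool, Computable D ∧
      ∀ (k n d : ℕ) (M : AffineCRA k n d), D M.code = true ↔ MassConverges M.sem) ∧
    (¬ ∃ D : CRACode → Bool, Computable D ∧
      ∀ (k : ℕ) (M : AffineCRA k 1 4), D M.code = true ↔ MassConverges M.sem) ∧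
    (∃ G : (I : PCPInstance) → AffineCRA I.length 1 4,
      Computable (fun I : PCPInstance => (G I).code) ∧
      ∀ I : PCPInstance,
        (¬ I.Solvable → HasSum (G I).sem 1) ∧
        (I.Solvable → MassInfinite (G I).sem)) := by
  have key : ¬ ∃ D : CRACode → Bool, Computable D ∧
      ∀ (k : ℕ) (M : AffineCRA k 1 4), D M.code = true ↔ MassConverges M.sem := by
    rintro ⟨D, hD, h⟩
    exact PCPInstance.not_computable_solvable (fun I => D I.toAffineCRA.code)
      (hD.comp PCPInstance.computable_code_toAffineCRA)
      fun I => (h _ _).trans I.massConverges_sem_iff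
  -- A decider for all sizes would in particular decide the case of one state and four registers.
  exact ⟨fun ⟨D, hD, h⟩ => key ⟨D, hD, fun k M => h k 1 4 M⟩, key, PCPInstance.toAffineCRA,
    PCPInstance.computable_code_toAffineCRA, fun I =>
      ⟨PCPInstance.hasSum_sem_of_not_solvable, PCPInstance.massInfinite_sem_of_solvable⟩⟩
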